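/- Let $p>0$ and $|\omega|<1$. Set $$\Phi(x)=\big((p+1)\,\mathrm{sech}^2(px)\big)^{1/(2p)},\qquad \Phi_\omega(x)=(1-\omega^2)^{1/(2p)}\,\Phi\big(\sqrt{1-\omega^2}\,x\big),\qquad \mathbf\Phi_\omega=(\Phi_\omega,-\omega\Phi_\omega),$$ where $\Phi_\omega$ is the ground state of $-\Phi''+(1-\omega^2)\Phi-|\Phi|^{2p}\Phi=0$ on $\mathbb R$. On the real space $L^2(\mathbb R)\times L^2(\mathbb R)$ consider the linearized matrix operator with domain $H^2(\mathbb R)\times L^2(\mathbb R)$, $$\mathcal L_\omega\begin{pmatrix}w_1\\ w_2\end{pmatrix}=\begin{pmatrix}-\partial_{xx}w_1+w_1-(2p+1)|\Phi_\omega|^{2p}w_1+\omega w_2\\ \omega w_1+w_2\end{pmatrix},$$ and on real $L^2(\mathbb R)$ the scalar operator $L_\omega^0=-\partial_{xx}+(1-\omega^2)-(2p+1)|\Phi_\omega|^{2p}$ with domain $H^2(\mathbb R)$. Then: 1. $\partial_x\mathbf\Phi_\omega\in L^2(\mathbb R)\times L^2(\mathbb R)$ and $\operatorname{Ker}(\mathcal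 L_\omega)=\{C\,\partial_x\mathbf\Phi_\omega: C\in\mathbb R\}$. 2. $L_\omega^0$ has exactly one negative eigenvalue $\lambda^-$, and it is simple: its eigenspace is spanned by one function $\psi_0\neq0$. 3. $\mathcal L_\omega$ has exactly one negative eigenvalue $\lambda_0$, namely $$\lambda_0=\tfrac12\Big(\lambda^-+\omega^2+1-\sqrt{(\lambda^-)^2+2(\omega^2-1)\lambda^-+(\omega^2+1)^2}\Big),$$ and it is simple: its eigenspace is spanned by $\mathbf\Gamma_0=\Big(\psi_0,\ \dfrac{\omega}{\lambda_0-1}\,\psi_0\Big)$. -/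

import Mathlib

open MeasureTheory
open scoped ENNReal

namespace GoodBoussinesq

noncomputable section

/-- The real Hilbert space `L²(ℝ)`. -/
abbrev L2 : Type := Lp ℝ 2 (volume : Measure ℝ)

/-! ### Weak derivatives and the Sobolev spaces `H¹(ℝ)`, `H²(ℝ)` -/

/-- `g ∈ L²(ℝ)` is the weak (distributional) derivative of `f ∈ L²(ℝ)`:
`∫ f φ' = - ∫ g φ` for all test functions `φ ∈ C_c^∞(ℝ)`. -/
def HasWeakDeriv (f g : L2) : Prop :=
  ∀ φ : ℝ → ℝ, ContDiff ℝ (⊤ : ℕ∞) φ → HasCompactSupport φ →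
    ∫ x, f x * deriv φ x = - ∫ x, g x * φ x

theorem integrable_mul_test (f : L2) {φ : ℝ → ℝ} (hφ : Continuous φ)
    (hc : HasCompactSupport φ) : Integrable (fun x => f x * φ x) :=
  MemLp.integrable_mul (p := 2) (q := 2) (Lp.memLp f) (hφ.memLp_of_hasCompactSupport hc)

theorem HasWeakDeriv.add {f₁ f₂ g₁ g₂ : L2} (h₁ : HasWeakDeriv f₁ g₁)
    (h₂ : HasWeakDeriv f₂ g₂) : HasWeakDeriv (f₁ + f₂) (g₁ + g₂) := by
  intro φ hφ hc
  have hd : Continuous (deriv φ) := hφ.continuous_deriv (by simp)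
  have e1 : ∫ x, (f₁ + f₂ : L2) x * deriv φ x
      = ∫ x, (f₁ x * deriv φ x + f₂ x * deriv φ x) := by
    refine integral_congr_ae ?_
    filter_upwards [Lp.coeFn_add f₁ f₂] with x hx
    rw [hx, Pi.add_apply, add_mul]
  have e2 : ∫ x, (g₁ + g₂ : L2) x * φ x = ∫ x, (g₁ x * φ x + g₂ x * φ x) := by
    refine integral_congr_ae ?_
    filter_upwards [Lp.coeFn_add g₁ g₂] with x hx
    rw [hx, Pi.add_apply, add_mul]
  rw [e1, e2, integral_add (integrable_mul_test f₁ hd hc.deriv)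
      (integrable_mul_test f₂ hd hc.deriv),
    integral_add (integrable_mul_test g₁ hφ.continuous hc)
      (integrable_mul_test g₂ hφ.continuous hc), h₁ φ hφ hc, h₂ φ hφ hc]
  ring

theorem HasWeakDeriv.smul {f g : L2} (c : ℝ) (h : HasWeakDeriv f g) :
    HasWeakDeriv (c • f) (c • g) := by
  intro φ hφ hc
  have e1 : ∫ x, (c • f : L2) x * deriv φ x = ∫ x, c * (f x * deriv φ x) := by
    refine integral_congr_ae ?_
    filter_upwards [Lp.coeFn_smul c f] with x hx
    rw [hx, Pi.smul_apply, smul_eq_mul, mul_assoc]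
  have e2 : ∫ x, (c • g : L2) x * φ x = ∫ x, c * (g x * φ x) := by
    refine integral_congr_ae ?_
    filter_upwards [Lp.coeFn_smul c g] with x hx
    rw [hx, Pi.smul_apply, smul_eq_mul, mul_assoc]
  rw [e1, e2, integral_const_mul, integral_const_mul, h φ hφ hc]
  ring

theorem HasWeakDeriv.zero : HasWeakDeriv 0 0 := by
  intro φ _ _
  have h : (((0 : L2) : ℝ → ℝ)) =ᵐ[volume] 0 := Lp.coeFn_zero _ _ _
  rw [integral_eq_zero_of_ae (by filter_upwards [h] with x hx; rw [hx]; simp),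
    integral_eq_zero_of_ae (by filter_upwards [h] with x hx; rw [hx]; simp), neg_zero]

/-- Weak derivatives are unique. -/
theorem HasWeakDeriv.unique {f g₁ g₂ : L2} (h₁ : HasWeakDeriv f g₁)
    (h₂ : HasWeakDeriv f g₂) : g₁ = g₂ := by
  have hl : ∀ g : L2, LocallyIntegrable g (volume : Measure ℝ) := fun g =>
    (Lp.memLp g).locallyIntegrable (by norm_num)
  have key : ∀ᵐ x : ℝ, g₁ x = g₂ x := by
    refine ae_eq_of_integral_contDiff_smul_eq (hl g₁) (hl g₂) ?_
    intro φ hφ hc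
    have := (h₁ φ hφ hc).symm.trans (h₂ φ hφ hc)
    simpa [smul_eq_mul, mul_comm] using this
  exact Lp.ext key

/-- The weak derivative as an unbounded operator on `L²(ℝ)`; its domain is the Sobolev space
`H¹(ℝ)` of all `f ∈ L²(ℝ)` that have a weak derivative in `L²(ℝ)`. -/
def weakDeriv : L2 →ₗ.[ℝ] L2 where
  domain :=
    { carrier := {f | ∃ g, HasWeakDeriv f g}
      add_mem' := fun ⟨g₁, h₁⟩ ⟨g₂, h₂⟩ => ⟨g₁ + g₂, h₁.add h₂⟩
      zero_mem' := ⟨0, HasWeakDeriv.zero⟩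
      smul_mem' := fun c _ ⟨g, h⟩ => ⟨c • g, h.smul c⟩ }
  toFun :=
    { toFun := fun f => f.2.choose
      map_add' := fun f₁ f₂ => (f₁ + f₂).2.choose_spec.unique
        (f₁.2.choose_spec.add f₂.2.choose_spec)
      map_smul' := fun c f => (c • f).2.choose_spec.unique (f.2.choose_spec.smul c) }

theorem hasWeakDeriv_weakDeriv (f : weakDeriv.domain) : HasWeakDeriv f (weakDeriv f) :=
  f.2.choose_spec

/-- The Sobolev space `H²(ℝ)` of all `f ∈ H¹(ℝ)` with `∂ₓ f ∈ H¹(ℝ)`. -/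
def sobolevH2 : Submodule ℝ L2 :=
  (weakDeriv.domain.comap weakDeriv.toFun).map weakDeriv.domain.subtype

theorem mem_sobolevH2_iff (f : L2) :
    f ∈ sobolevH2 ↔ ∃ h : f ∈ weakDeriv.domain, weakDeriv ⟨f, h⟩ ∈ weakDeriv.domain := by
  constructor
  · rintro ⟨g, hg, rfl⟩
    exact ⟨g.2, hg⟩
  · rintro ⟨h, h'⟩
    exact ⟨⟨f, h⟩, h', rfl⟩

theorem sobolevH2.mem₁ (f : sobolevH2) : (f : L2) ∈ weakDeriv.domain :=
  ((mem_sobolevH2_iff f).1 f.2).1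

theorem sobolevH2.mem₂ (f : sobolevH2) :
    weakDeriv ⟨f, sobolevH2.mem₁ f⟩ ∈ weakDeriv.domain :=
  ((mem_sobolevH2_iff f).1 f.2).2

/-- The second weak derivative `∂ₓₓ` as an unbounded operator on `L²(ℝ)` with domain `H²(ℝ)`. -/
def weakDeriv₂ : L2 →ₗ.[ℝ] L2 where
  domain := sobolevH2
  toFun :=
    { toFun := fun f => weakDeriv ⟨weakDeriv ⟨f, sobolevH2.mem₁ f⟩, sobolevH2.mem₂ f⟩
      map_add' := fun f₁ f₂ => by
        rw [← LinearPMap.map_add]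
        congr 1
        apply Subtype.ext
        exact LinearPMap.map_add weakDeriv ⟨f₁, sobolevH2.mem₁ f₁⟩ ⟨f₂, sobolevH2.mem₁ f₂⟩
      map_smul' := fun c f => by
        rw [RingHom.id_apply, ← LinearPMap.map_smul]
        congr 1
        apply Subtype.ext
        exact LinearPMap.map_smul weakDeriv c ⟨f, sobolevH2.mem₁ f⟩ }

/-! ### The solitary wave profile -/

/-- `Φ(x) = ((p+1) sech²(p x))^{1/(2p)}`. -/
def groundState (p : ℝ) (x : ℝ) : ℝ :=
  ((p + 1) * (1 / Real.cosh (p * x)) ^ 2) ^ (1 / (2 * p))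

/-- `Φ_ω(x) = (1-ω²)^{1/(2p)} Φ(√(1-ω²) x)`. -/
def Phi (p ω : ℝ) (x : ℝ) : ℝ :=
  (1 - ω ^ 2) ^ (1 / (2 * p)) * groundState p (√(1 - ω ^ 2) * x)

theorem memLp_top_potential {p : ℝ} (ω : ℝ) (hp : 0 < p) :
    MemLp (fun x => |Phi p ω x| ^ (2 * p)) ∞ (volume : Measure ℝ) := by
  have hpos : 0 ≤ 1 / (2 * p) := by positivity
  have hcont : Continuous (fun x => |Phi p ω x| ^ (2 * p)) := by
    have h1 : Continuous (groundState p) := by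
      unfold groundState
      refine Continuous.rpow_const ?_ (fun _ => Or.inr hpos)
      refine continuous_const.mul (Continuous.pow ?_ 2)
      exact continuous_const.div (Real.continuous_cosh.comp (continuous_const.mul continuous_id))
        (fun x => (Real.cosh_pos _).ne')
    refine Continuous.rpow_const ?_ (fun _ => Or.inr (by positivity))
    exact (continuous_const.mul (h1.comp (continuous_const.mul continuous_id))).abs
  refine memLp_top_of_bound hcont.aestronglyMeasurable
    ((|(1 - ω ^ 2) ^ (1 / (2 * p))| * (p + 1) ^ (1 / (2 * p))) ^ (2 * p))
    (Filter.Eventually.of_forall fun x => ?_)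
  rw [Real.norm_of_nonneg (by positivity)]
  refine Real.rpow_le_rpow (abs_nonneg _) ?_ (by positivity)
  rw [Phi, abs_mul]
  refine mul_le_mul_of_nonneg_left ?_ (abs_nonneg _)
  unfold groundState
  rw [abs_of_nonneg (by positivity)]
  refine Real.rpow_le_rpow (by positivity) ?_ hpos
  have h1 := Real.one_le_cosh (p * (√(1 - ω ^ 2) * x))
  have h2 : 1 / Real.cosh (p * (√(1 - ω ^ 2) * x)) ≤ 1 := by
    rw [div_le_one (by positivity)]; exact h1
  have h3 : (1 / Real.cosh (p * (√(1 - ω ^ 2) * x))) ^ 2 ≤ 1 := pow_le_one₀ (by positivity) h2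
  nlinarith

/-- The function `|Φ_ω|^{2p}` as an element of `L^∞(ℝ)`. -/
def potential (p ω : ℝ) (hp : 0 < p) : Lp ℝ ∞ (volume : Measure ℝ) :=
  (memLp_top_potential ω hp).toLp

/-- The bounded operator of multiplication by `|Φ_ω|^{2p}` on `L²(ℝ)`. -/
def mulPotential (p ω : ℝ) (hp : 0 < p) : L2 →ₗ[ℝ] L2 where
  toFun f := potential p ω hp • f
  map_add' f g := Lp.add_smul (potential p ω hp) f g
  map_smul' c f := (Lp.smul_comm c (potential p ω hp) f).symm

/-! ### The linearized operators -/

/-- The scalar operator `-∂ₓₓ + (1-ω²) - (2p+1) |Φ_ω|^{2p}` on `L²(ℝ)` with domain `H²(ℝ)`. -/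
def scalarOp (p ω : ℝ) (hp : 0 < p) : L2 →ₗ.[ℝ] L2 where
  domain := weakDeriv₂.domain
  toFun := - weakDeriv₂.toFun
    + ((1 - ω ^ 2) • LinearMap.id - (2 * p + 1) • mulPotential p ω hp)
        ∘ₗ weakDeriv₂.domain.subtype

/-- The operator `L = -∂ₓₓ + 1 - (2p+1) |Φ_ω|^{2p}` on `L²(ℝ)` with domain `H²(ℝ)`; it is the
upper left entry of the linearized matrix operator. -/
def upperLeftOp (p ω : ℝ) (hp : 0 < p) : L2 →ₗ.[ℝ] L2 where
  domain := weakDeriv₂.domain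
  toFun := - weakDeriv₂.toFun
    + (LinearMap.id - (2 * p + 1) • mulPotential p ω hp) ∘ₗ weakDeriv₂.domain.subtype

/-- The linearized matrix operator `(w₁, w₂) ↦ (L w₁ + ω w₂, ω w₁ + w₂)` on `L²(ℝ) × L²(ℝ)`
with domain `H²(ℝ) × L²(ℝ)`. -/
def matrixOp (p ω : ℝ) (hp : 0 < p) : (L2 × L2) →ₗ.[ℝ] (L2 × L2) where
  domain := (upperLeftOp p ω hp).domain.prod ⊤
  toFun :=
    { toFun := fun w =>
        (upperLeftOp p ω hp ⟨w.1.1, w.2.1⟩ + ω • w.1.2, ω • w.1.1 + w.1.2)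
      map_add' := fun v w => by
        refine Prod.ext ?_ ?_
        · have h := LinearPMap.map_add (upperLeftOp p ω hp) ⟨v.1.1, v.2.1⟩ ⟨w.1.1, w.2.1⟩
          change upperLeftOp p ω hp (⟨v.1.1, v.2.1⟩ + ⟨w.1.1, w.2.1⟩) + ω • (v.1.2 + w.1.2) = _
          rw [h, smul_add]
          exact add_add_add_comm _ _ _ _
        · change ω • (v.1.1 + w.1.1) + (v.1.2 + w.1.2) = _
          rw [smul_add]
          exact add_add_add_comm _ _ _ _
      map_smul' := fun c w => by
        refine Prod.ext ?_ ?_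
        · have h := LinearPMap.map_smul (upperLeftOp p ω hp) c ⟨w.1.1, w.2.1⟩
          change upperLeftOp p ω hp (c • ⟨w.1.1, w.2.1⟩) + ω • (c • w.1.2) = _
          rw [h, smul_comm ω c, ← smul_add]
          rfl
        · change ω • (c • w.1.1) + c • w.1.2 = _
          rw [smul_comm ω c, ← smul_add]
          rfl }

/-! ### Eigenvalues of unbounded operators -/

/-- The eigenspace `{w ∈ dom T : T w = μ w}` of an unbounded operator; for `μ = 0` it is the
kernel of `T`. -/
def eigenspace {E : Type*} [AddCommGroup E] [Module ℝ E] (T : E →ₗ.[ℝ] E) (μ : ℝ) :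
    Submodule ℝ E :=
  (LinearMap.ker (T.toFun - μ • T.domain.subtype)).map T.domain.subtype

/-- The kernel `{w ∈ dom T : T w = 0}` of an unbounded operator. -/
def kernel {E : Type*} [AddCommGroup E] [Module ℝ E] (T : E →ₗ.[ℝ] E) : Submodule ℝ E :=
  (LinearMap.ker T.toFun).map T.domain.subtype

/-- `μ` is an eigenvalue of `T`: there is a nonzero `w ∈ dom T` with `T w = μ w`. -/
def IsEigenvalue {E : Type*} [AddCommGroup E] [Module ℝ E] (T : E →ₗ.[ℝ] E) (μ : ℝ) : Prop :=
  ∃ w ∈ eigenspace T μ, w ≠ 0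

end

end GoodBoussinesq

/-! For `l ≠ 1` the second row of the eigenvalue equation gives `w₂ = ω/(l-1) w₁`, and the first row
becomes a scalar eigenvalue problem with parameter `m = l - ω² l/(l-1)`
(`mem_eigenspace_matrixOp_iff`). Negative `l` gives negative `m`. For fixed `m < 0` the relation is
a quadratic in `l` whose roots have product `m`, so exactly one is negative; `l = 0` gives `m = 0`.
Everything thus reduces to the scalar operator at nonpositive eigenvalues.

With `a = √(1-ω²)` its potential is a multiple of `sech²(p a x)`, and it factors twice. Put `A = ∂ +
(p+1) a tanh` and `B = ∂ + a tanh`, with formal adjoints `A*`, `B*`. Then `L = A*A - p(p+2)a²` and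
`AA* - p(p+2)a² = B*B`. If `L u = l u` and `v = A u`, then `B*B v = l v`, so `‖B v‖² = l ‖v‖²`
(`integral_darboux₂_sq`). For `l < 0` this forces `A u = 0`, which fixes both `u`, a multiple of
`sech^((p+1)/p)`, and `l = -p(p+2)a²`. For `l = 0` it forces `B A u = 0`, leaving only multiples of
`∂ₓ Φ_ω`.

These are identities for classical solutions; `exists_isClassicalEigenfunction` supplies such
solutions from weak ones through the du Bois-Reymond lemma. -/

namespace GoodBoussinesq

/-! ### Weakly differentiable functions on the line -/

/-- A continuous compactly supported function on the line is supported in a bounded interval. -/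
theorem exists_support_subset_Ioo {ψ : ℝ → ℝ} (hc : HasCompactSupport ψ) :
    ∃ R : ℝ, 0 < R ∧ ∀ x, x ∉ Set.Ioo (-R) R → ψ x = 0 := by
  obtain ⟨R, hR⟩ := hc.isCompact.isBounded.subset_closedBall 0
  refine ⟨max R 0 + 1, by positivity, fun x hx => ?_⟩
  by_contra h
  have h1 := hR (subset_tsupport _ h)
  rw [mem_closedBall_zero_iff, Real.norm_eq_abs] at h1
  refine hx (abs_lt.1 (h1.trans_lt ?_))
  linarith [le_max_left R 0]

theorem support_subset_Ioc {ψ : ℝ → ℝ} {R : ℝ} (h : ∀ x, x ∉ Set.Ioo (-R) R → ψ x = 0) :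
    Function.support ψ ⊆ Set.Ioc (-R) R := fun x hx =>
  Set.Ioo_subset_Ioc_self (by_contra fun hx' => hx (h x hx'))

/-- A test function of integral zero is the derivative of a test function. -/
theorem exists_test_antideriv {ψ : ℝ → ℝ} (hψ : ContDiff ℝ (⊤ : ℕ∞) ψ)
    (hc : HasCompactSupport ψ) (h0 : ∫ x, ψ x = 0) :
    ∃ φ : ℝ → ℝ, ContDiff ℝ (⊤ : ℕ∞) φ ∧ HasCompactSupport φ ∧ deriv φ = ψ := by
  obtain ⟨R, hR, hs⟩ := exists_support_subset_Ioo hc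
  have hd : ∀ x, HasDerivAt (fun x => ∫ t in (-R)..x, ψ t) (ψ x) x := fun x =>
    hψ.continuous.integral_hasStrictDerivAt _ x |>.hasDerivAt
  have hderiv : deriv (fun x => ∫ t in (-R)..x, ψ t) = ψ := funext fun x => (hd x).deriv
  refine ⟨fun x => ∫ t in (-R)..x, ψ t, ?_, ?_, hderiv⟩
  · rw [contDiff_infty_iff_deriv, hderiv]
    exact ⟨fun x => (hd x).differentiableAt, hψ⟩
  · refine HasCompactSupport.intro (K := Set.Icc (-R) R) isCompact_Icc fun x hx => ?_
    rcases lt_or_ge x (-R) with h | h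
    · refine intervalIntegral.integral_zero_ae (Filter.Eventually.of_forall fun t ht => hs t ?_)
      rw [Set.uIoc_of_ge h.le] at ht
      exact fun h' => absurd ht.2 (not_le.2 h'.1)
    · have h2 : R < x := not_le.1 fun h' => hx ⟨h, h'⟩
      show ∫ t in (-R)..x, ψ t = 0
      rw [intervalIntegral.integral_eq_integral_of_support_subset, h0]
      exact (support_subset_Ioc hs).trans (Set.Ioc_subset_Ioc_right h2.le)

/-- The du Bois-Reymond lemma: a locally integrable function with vanishing weak derivative is
almost everywhere constant. -/
theorem ae_eq_const_of_forall_integral_mul_deriv_eq_zero {h : ℝ → ℝ}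
    (hh : LocallyIntegrable h volume)
    (h0 : ∀ φ : ℝ → ℝ, ContDiff ℝ (⊤ : ℕ∞) φ → HasCompactSupport φ →
      ∫ x, h x * deriv φ x = 0) :
    ∃ c : ℝ, h =ᵐ[volume] fun _ => c := by
  let η : ContDiffBump (0 : ℝ) := ⟨1, 2, one_pos, one_lt_two⟩
  have hη : ContDiff ℝ (⊤ : ℕ∞) (η.normed volume) := η.contDiff_normed
  have hηc : HasCompactSupport (η.normed volume) := η.hasCompactSupport_normed
  have hη1 : ∫ x, η.normed volume x = 1 := η.integral_normed
  have hint : ∀ ψ : ℝ → ℝ, ContDiff ℝ (⊤ : ℕ∞) ψ → HasCompactSupport ψ →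
      Integrable (fun x => h x * ψ x) := fun ψ hψ hc => by
    simpa [mul_comm] using hh.integrable_smul_left_of_hasCompactSupport hψ.continuous hc
  refine ⟨∫ x, h x * η.normed volume x, ?_⟩
  refine ae_eq_of_integral_contDiff_smul_eq hh continuous_const.locallyIntegrable ?_
  intro ψ hψ hc
  have hψi : Integrable ψ := hψ.continuous.integrable_of_hasCompactSupport hc
  have hηi : Integrable (η.normed volume) := hη.continuous.integrable_of_hasCompactSupport hηc
  -- Subtracting its mass times the normalized bump makes `ψ` mean zero, hence a derivative of a
  -- test function; testing then gives `∫ h ψ = c ∫ ψ`.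
  obtain ⟨φ, hφ, hφc, hd⟩ := exists_test_antideriv
    (ψ := fun x => ψ x - (∫ y, ψ y) * η.normed volume x) (hψ.sub (contDiff_const.mul hη))
    (hc.sub (hηc.mul_left (f := fun _ => ∫ y, ψ y)))
    (by rw [integral_sub hψi (hηi.const_mul _), integral_const_mul, hη1]; ring)
  have key := h0 φ hφ hφc
  rw [hd] at key
  have e : (fun x => h x * (ψ x - (∫ y, ψ y) * η.normed volume x))
      = fun x => h x * ψ x - (∫ y, ψ y) * (h x * η.normed volume x) := by
    funext x; ring
  rw [e, integral_sub (hint ψ hψ hc) ((hint _ hη hηc).const_mul _), integral_const_mul] at key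
  simp only [smul_eq_mul, integral_mul_const]
  simp only [mul_comm (ψ _)]
  linarith

/-- The primitive is absolutely continuous on an interval containing the support of `φ`, so
integration by parts applies without boundary terms; its derivative is `g` almost everywhere by
Lebesgue differentiation. -/
theorem integral_primitive_mul_deriv {g φ : ℝ → ℝ} (hg : LocallyIntegrable g volume)
    (hφ : ContDiff ℝ (⊤ : ℕ∞) φ) (hc : HasCompactSupport φ) :
    ∫ x, (∫ t in (0 : ℝ)..x, g t) * deriv φ x = - ∫ x, g x * φ x := by
  obtain ⟨R, hR, hs⟩ := exists_support_subset_Ioo hc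
  obtain ⟨R', hR', hs'⟩ := exists_support_subset_Ioo hc.deriv
  set r := max R R' with hr
  have hsr : ∀ x, x ∉ Set.Ioo (-r) r → φ x = 0 := fun x hx => hs x fun h =>
    hx ⟨by linarith [h.1, le_max_left R R'], by linarith [h.2, le_max_left R R']⟩
  have hsr' : ∀ x, x ∉ Set.Ioo (-r) r → deriv φ x = 0 := fun x hx => hs' x fun h =>
    hx ⟨by linarith [h.1, le_max_right R R'], by linarith [h.2, le_max_right R R']⟩
  have hr0 : 0 < r := lt_of_lt_of_le hR (le_max_left _ _)
  have hgi : IntervalIntegrable g volume (-r) r :=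
    (hg.integrableOn_isCompact isCompact_uIcc).intervalIntegrable
  have hG := hgi.absolutelyContinuousOnInterval_intervalIntegral (c := 0)
    (by rw [Set.uIcc_of_le (by linarith)]; exact ⟨by linarith, hr0.le⟩)
  have hφa : AbsolutelyContinuousOnInterval φ (-r) r :=
    ContDiffOn.absolutelyContinuousOnInterval ((hφ.of_le (by norm_cast)).contDiffOn)
  have hibp := hG.integral_mul_deriv_eq_deriv_mul hφa
  rw [← intervalIntegral.integral_eq_integral_of_support_subset (a := -r) (b := r),
    ← intervalIntegral.integral_eq_integral_of_support_subset (a := -r) (b := r), hibp,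
    hsr r (by simp), hsr (-r) (by simp)]
  · simp only [mul_zero, sub_zero, zero_sub, neg_inj]
    refine intervalIntegral.integral_congr_ae ?_
    filter_upwards [LocallyIntegrable.ae_hasDerivAt_integral hg] with x hx _
    rw [(hx 0).deriv]
  · exact support_subset_Ioc fun x hx => by rw [hsr x hx, mul_zero]
  · exact support_subset_Ioc fun x hx => by rw [hsr' x hx, mul_zero]

theorem L2.locallyIntegrable (g : L2) : LocallyIntegrable g (volume : Measure ℝ) :=
  (Lp.memLp g).locallyIntegrable (by norm_num)

theorem L2.continuous_primitive (g : L2) : Continuous fun x => ∫ t in (0 : ℝ)..x, g t :=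
  intervalIntegral.continuous_primitive (fun _ _ =>
    ((L2.locallyIntegrable g).integrableOn_isCompact isCompact_uIcc).intervalIntegrable) 0

/-- A function in `H¹(ℝ)` is, up to a constant, the primitive of its weak derivative. -/
theorem HasWeakDeriv.exists_ae_eq_primitive {f g : L2} (h : HasWeakDeriv f g) :
    ∃ c : ℝ, f =ᵐ[volume] fun x => c + ∫ t in (0 : ℝ)..x, g t := by
  have hG := L2.continuous_primitive g
  obtain ⟨c, hc⟩ := ae_eq_const_of_forall_integral_mul_deriv_eq_zero
    (h := fun x => f x - ∫ t in (0 : ℝ)..x, g t)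
    ((L2.locallyIntegrable f).sub hG.locallyIntegrable) (by
      intro φ hφ hφc
      have hd : Continuous (deriv φ) := hφ.continuous_deriv (by simp)
      have i2 : Integrable (fun x => (∫ t in (0 : ℝ)..x, g t) * deriv φ x) :=
        (hG.mul hd).integrable_of_hasCompactSupport hφc.deriv.mul_left
      simp only [sub_mul]
      rw [integral_sub (integrable_mul_test f hd hφc.deriv) i2, h φ hφ hφc,
        integral_primitive_mul_deriv (L2.locallyIntegrable g) hφ hφc, sub_self])
  refine ⟨c, ?_⟩
  filter_upwards [hc] with x hx
  linarith

/-- A function in `H¹(ℝ)` whose weak derivative has a continuous representative is `C¹`. -/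
theorem HasWeakDeriv.exists_hasDerivAt {f g : L2} (h : HasWeakDeriv f g) {g' : ℝ → ℝ}
    (hg' : Continuous g') (hgg' : g =ᵐ[volume] g') :
    ∃ f' : ℝ → ℝ, f =ᵐ[volume] f' ∧ ∀ x, HasDerivAt f' (g' x) x := by
  obtain ⟨c, hc⟩ := h.exists_ae_eq_primitive
  refine ⟨fun x => c + ∫ t in (0 : ℝ)..x, g' t, ?_, fun x => ?_⟩
  · filter_upwards [hc] with x hx
    rw [hx, intervalIntegral.integral_congr_ae (by filter_upwards [hgg'] with t ht _ using ht)]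
  · exact ((hg'.integral_hasStrictDerivAt _ x).hasDerivAt).const_add c

theorem integrable_mul_of_memLp_two {f g : ℝ → ℝ} (hf : MemLp f 2 volume)
    (hg : MemLp g 2 volume) : Integrable (fun x => f x * g x) :=
  MemLp.integrable_mul (p := 2) (q := 2) hf hg

theorem integral_mul_deriv_eq_neg_of_memLp {f f' g g' : ℝ → ℝ} (hf : ∀ x, HasDerivAt f (f' x) x)
    (hg : ∀ x, HasDerivAt g (g' x) x) (f2 : MemLp f 2 volume) (f2' : MemLp f' 2 volume)
    (g2 : MemLp g 2 volume) (g2' : MemLp g' 2 volume) :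
    ∫ x, f x * g' x = - ∫ x, f' x * g x :=
  integral_mul_deriv_eq_deriv_mul_of_integrable (fun x _ => hf x) (fun x _ => hg x)
    (integrable_mul_of_memLp_two f2 g2') (integrable_mul_of_memLp_two f2' g2)
    (integrable_mul_of_memLp_two f2 g2)

/-- The classical derivative of a differentiable function is its weak derivative. -/
theorem hasWeakDeriv_toLp {f f' : ℝ → ℝ} (hf : ∀ x, HasDerivAt f (f' x) x)
    (f2 : MemLp f 2 volume) (f2' : MemLp f' 2 volume) :
    HasWeakDeriv (f2.toLp f) (f2'.toLp f') := by
  intro φ hφ hc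
  have hd : Continuous (deriv φ) := hφ.continuous_deriv (by simp)
  have e1 : ∫ x, f2.toLp f x * deriv φ x = ∫ x, f x * deriv φ x := by
    refine integral_congr_ae ?_
    filter_upwards [f2.coeFn_toLp] with x hx
    rw [hx]
  have e2 : ∫ x, f2'.toLp f' x * φ x = ∫ x, f' x * φ x := by
    refine integral_congr_ae ?_
    filter_upwards [f2'.coeFn_toLp] with x hx
    rw [hx]
  rw [e1, e2]
  exact integral_mul_deriv_eq_neg_of_memLp hf
    (fun x => (hφ.differentiable (by simp) x).hasDerivAt) f2 f2'
    (hφ.continuous.memLp_of_hasCompactSupport hc) (hd.memLp_of_hasCompactSupport hc.deriv)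

end GoodBoussinesq

namespace GoodBoussinesq

/-! ### Eigenspaces of the linearized operators -/

theorem mem_eigenspace_iff {E : Type*} [AddCommGroup E] [Module ℝ E] {T : E →ₗ.[ℝ] E} {μ : ℝ}
    {w : E} : w ∈ eigenspace T μ ↔ ∃ h : w ∈ T.domain, T ⟨w, h⟩ = μ • w := by
  constructor
  · rintro ⟨v, hv, rfl⟩
    exact ⟨v.2, sub_eq_zero.1 hv⟩
  · rintro ⟨h, h'⟩
    exact ⟨⟨w, h⟩, sub_eq_zero.2 h', rfl⟩

theorem kernel_eq_eigenspace_zero {E : Type*} [AddCommGroup E] [Module ℝ E] (T : E →ₗ.[ℝ] E) :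
    kernel T = eigenspace T 0 := by
  rw [kernel, eigenspace, zero_smul, sub_zero]

theorem weakDeriv_eq {f g : L2} (h : HasWeakDeriv f g) (hf : f ∈ weakDeriv.domain) :
    weakDeriv ⟨f, hf⟩ = g :=
  (hasWeakDeriv_weakDeriv ⟨f, hf⟩).unique h

/-- Trades the chosen values inside the operators for the relation `HasWeakDeriv`, which the later
arguments use. -/
theorem weakDeriv₂_eq_iff {f k : L2} :
    (∃ h : f ∈ weakDeriv₂.domain, weakDeriv₂ ⟨f, h⟩ = k) ↔
      ∃ g, HasWeakDeriv f g ∧ HasWeakDeriv g k := by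
  constructor
  · rintro ⟨h, rfl⟩
    exact ⟨_, hasWeakDeriv_weakDeriv ⟨f, sobolevH2.mem₁ ⟨f, h⟩⟩,
      hasWeakDeriv_weakDeriv ⟨_, sobolevH2.mem₂ ⟨f, h⟩⟩⟩
  · rintro ⟨g, h₁, h₂⟩
    have hf : f ∈ weakDeriv.domain := ⟨g, h₁⟩
    have hfg : weakDeriv ⟨f, hf⟩ = g := weakDeriv_eq h₁ hf
    have hg : weakDeriv ⟨f, hf⟩ ∈ weakDeriv.domain := ⟨k, by rw [hfg]; exact h₂⟩
    exact ⟨(mem_sobolevH2_iff f).2 ⟨hf, hg⟩, weakDeriv_eq (by rw [hfg]; exact h₂) hg⟩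

variable {p ω : ℝ} {hp : 0 < p}

theorem mem_eigenspace_scalarOp_iff_weakDeriv₂ {l : ℝ} {f : L2} :
    f ∈ eigenspace (scalarOp p ω hp) l ↔ ∃ h : f ∈ weakDeriv₂.domain,
      weakDeriv₂ ⟨f, h⟩ = (1 - ω ^ 2 - l) • f - (2 * p + 1) • mulPotential p ω hp f := by
  rw [mem_eigenspace_iff]
  refine exists_congr fun h => ?_
  change -weakDeriv₂ ⟨f, h⟩ + ((1 - ω ^ 2) • f - (2 * p + 1) • mulPotential p ω hp f) = l • f ↔ _
  rw [neg_add_eq_iff_eq_add, eq_comm, sub_smul (1 - ω ^ 2) l f, eq_comm, sub_right_comm,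
    eq_sub_iff_add_eq', eq_comm, add_comm]

theorem mem_eigenspace_scalarOp_iff {l : ℝ} {f : L2} :
    f ∈ eigenspace (scalarOp p ω hp) l ↔ ∃ g, HasWeakDeriv f g ∧
      HasWeakDeriv g ((1 - ω ^ 2 - l) • f - (2 * p + 1) • mulPotential p ω hp f) :=
  mem_eigenspace_scalarOp_iff_weakDeriv₂.trans weakDeriv₂_eq_iff

/-- Elimination of the second component from the eigenvalue equation of the matrix operator. -/
theorem mem_eigenspace_matrixOp_iff {l : ℝ} (hl : l ≠ 1) {w : L2 × L2} :
    w ∈ eigenspace (matrixOp p ω hp) l ↔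
      w.1 ∈ eigenspace (scalarOp p ω hp) (l - ω ^ 2 * l / (l - 1)) ∧
        w.2 = (ω / (l - 1)) • w.1 := by
  have hl' : l - 1 ≠ 0 := sub_ne_zero.2 hl
  have h2 : ω • w.1 + w.2 = l • w.2 ↔ w.2 = (ω / (l - 1)) • w.1 := by
    constructor
    · intro h
      have h' : (l - 1) • w.2 = ω • w.1 := by
        rw [sub_smul, one_smul, ← h, add_sub_cancel_right]
      rw [div_eq_inv_mul, mul_smul, ← h', smul_smul, inv_mul_cancel₀ hl', one_smul]
    · intro h
      rw [h, smul_smul, ← add_smul ω (ω / (l - 1)) w.1]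
      congr 1
      field_simp
      ring
  -- This rests on `1 + 1/(l-1) = l/(l-1)`: the coupling term turns the first row into the scalar
  -- equation with the shifted eigenvalue.
  have hc : ω * (ω / (l - 1)) = l - 1 + (1 - ω ^ 2 - (l - ω ^ 2 * l / (l - 1))) := by
    field_simp
    ring
  rw [mem_eigenspace_iff, mem_eigenspace_scalarOp_iff_weakDeriv₂]
  constructor
  · rintro ⟨h, h'⟩
    have e2 := h2.1 (congrArg Prod.snd h')
    refine ⟨⟨h.1, ?_⟩, e2⟩
    have e1 : -weakDeriv₂ ⟨w.1, h.1⟩ + (w.1 - (2 * p + 1) • mulPotential p ω hp w.1) + ω • w.2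
      = l • w.1 := congrArg Prod.fst h'
    rw [e2, smul_smul, hc] at e1
    rw [← sub_eq_zero] at e1 ⊢
    rw [← neg_eq_zero, ← e1]
    module
  · rintro ⟨⟨h, h'⟩, e2⟩
    refine ⟨⟨h, trivial⟩, Prod.ext ?_ (h2.2 e2)⟩
    change -weakDeriv₂ ⟨w.1, h⟩ + (w.1 - (2 * p + 1) • mulPotential p ω hp w.1) + ω • w.2
      = l • w.1
    rw [e2, smul_smul, h', hc]
    module

end GoodBoussinesq

namespace GoodBoussinesq

/-! ### Hyperbolic functions -/

theorem hasDerivAt_tanh_mul (b x : ℝ) :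
    HasDerivAt (fun y => Real.tanh (b * y)) (b * (1 - Real.tanh (b * x) ^ 2)) x := by
  have hb : HasDerivAt (fun y : ℝ => b * y) b x := by simpa using (hasDerivAt_id x).const_mul b
  have h := hb.sinh.div hb.cosh (Real.cosh_pos _).ne'
  have e : (fun y => Real.tanh (b * y)) = fun y => Real.sinh (b * y) / Real.cosh (b * y) :=
    funext fun y => Real.tanh_eq_sinh_div_cosh _
  rw [e]
  refine h.congr_deriv ?_
  rw [Real.tanh_eq_sinh_div_cosh]
  have := (Real.cosh_pos (b * x)).ne'
  field_simp

theorem continuous_tanh_mul (b : ℝ) : Continuous fun y => Real.tanh (b * y) :=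
  continuous_iff_continuousAt.2 fun x => (hasDerivAt_tanh_mul b x).continuousAt

/-- The function `sech^t (b x)`. -/
noncomputable def sechPow (b t x : ℝ) : ℝ := Real.cosh (b * x) ^ (-t)

theorem sechPow_pos (b t x : ℝ) : 0 < sechPow b t x := Real.rpow_pos_of_pos (Real.cosh_pos _) _

theorem hasDerivAt_sechPow (b t x : ℝ) :
    HasDerivAt (sechPow b t) (-(t * b) * (Real.tanh (b * x) * sechPow b t x)) x := by
  have hb : HasDerivAt (fun y : ℝ => b * y) b x := by simpa using (hasDerivAt_id x).const_mul b
  have hc := Real.cosh_pos (b * x)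
  refine (hb.cosh.rpow_const (p := -t) (Or.inl hc.ne')).congr_deriv ?_
  rw [sechPow, Real.tanh_eq_sinh_div_cosh, Real.rpow_sub_one hc.ne']
  field_simp

theorem continuous_sechPow (b t : ℝ) : Continuous (sechPow b t) :=
  continuous_iff_continuousAt.2 fun x => (hasDerivAt_sechPow b t x).continuousAt

theorem sechPow_sq (b t x : ℝ) : sechPow b t x ^ 2 = sechPow b (2 * t) x := by
  rw [sechPow, sechPow, ← Real.rpow_natCast, ← Real.rpow_mul (Real.cosh_pos _).le]
  congr 1
  push_cast
  ring

/-- Follows from `cosh y ≥ e^y / 2`. For `b, t > 0` it gives decay on the right half-line only;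
evenness covers the left. -/
theorem sechPow_le_exp {t : ℝ} (ht : 0 ≤ t) (b x : ℝ) :
    sechPow b t x ≤ 2 ^ t * Real.exp (-(t * b) * x) := by
  have h1 : Real.exp (b * x) / 2 ≤ Real.cosh (b * x) := by
    rw [Real.cosh_eq]
    linarith [Real.exp_pos (-(b * x))]
  refine (Real.rpow_le_rpow_of_nonpos (by positivity) h1 (by linarith)).trans_eq ?_
  rw [Real.div_rpow (Real.exp_pos _).le zero_le_two, Real.rpow_neg zero_le_two, div_inv_eq_mul,
    mul_comm, ← Real.exp_mul]
  congr 2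
  ring

theorem sechPow_neg (b t x : ℝ) : sechPow b t (-x) = sechPow b t x := by
  rw [sechPow, sechPow, mul_neg, Real.cosh_neg]

theorem integrable_sechPow {b t : ℝ} (hb : 0 < b) (ht : 0 < t) :
    Integrable (sechPow b t) := by
  have h1 : IntegrableOn (sechPow b t) (Set.Ioi 0) := by
    refine Integrable.mono' ((integrableOn_exp_mul_Ioi
      (neg_lt_zero.2 (mul_pos ht hb)) 0).const_mul (2 ^ t))
      (continuous_sechPow b t).aestronglyMeasurable (Filter.Eventually.of_forall fun x => ?_)
    rw [Real.norm_of_nonneg (sechPow_pos b t x).le]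
    exact sechPow_le_exp ht.le b x
  have h2 : IntegrableOn (sechPow b t) (Set.Iic 0) := by
    refine Integrable.mono' ((integrableOn_exp_mul_Iic (mul_pos ht hb) 0).const_mul (2 ^ t))
      (continuous_sechPow b t).aestronglyMeasurable (Filter.Eventually.of_forall fun x => ?_)
    rw [Real.norm_of_nonneg (sechPow_pos b t x).le, ← sechPow_neg, ← neg_mul_neg (t * b)]
    exact sechPow_le_exp ht.le b (-x)
  rw [← integrableOn_univ, ← Set.Iic_union_Ioi (a := (0 : ℝ))]
  exact h2.union h1

theorem memLp_sechPow {b t : ℝ} (hb : 0 < b) (ht : 0 < t) :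
    MemLp (sechPow b t) 2 volume := by
  rw [memLp_two_iff_integrable_sq (continuous_sechPow b t).aestronglyMeasurable]
  simp only [sechPow_sq]
  exact integrable_sechPow hb (by positivity)

theorem _root_.MeasureTheory.MemLp.tanh_mul {f : ℝ → ℝ} (hf : MemLp f 2 volume) (b : ℝ) :
    MemLp (fun x => Real.tanh (b * x) * f x) 2 volume := by
  refine hf.of_le ((continuous_tanh_mul b).aestronglyMeasurable.mul hf.1)
    (Filter.Eventually.of_forall fun x => ?_)
  rw [norm_mul, Real.norm_eq_abs]
  exact mul_le_of_le_one_left (norm_nonneg _) (Real.abs_tanh_lt_one _).le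

/-- The solutions of `u' = - t b tanh(b x) u` are the multiples of `sech^t (b x)`. -/
theorem exists_eq_mul_sechPow {b t : ℝ} {u : ℝ → ℝ}
    (hu : ∀ x, HasDerivAt u (-(t * b) * (Real.tanh (b * x) * u x)) x) :
    ∃ C : ℝ, ∀ x, u x = C * sechPow b t x := by
  have hd : ∀ x, HasDerivAt (fun x => u x / sechPow b t x) 0 x := fun x => by
    refine ((hu x).div (hasDerivAt_sechPow b t x) (sechPow_pos b t x).ne').congr_deriv ?_
    have := (sechPow_pos b t x).ne'
    field_simp
    ring
  refine ⟨u 0 / sechPow b t 0, fun x => ?_⟩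
  have h := is_const_of_deriv_eq_zero (fun x => (hd x).differentiableAt)
    (fun x => (hd x).deriv) x 0
  rw [← h]
  exact (div_mul_cancel₀ _ (sechPow_pos b t x).ne').symm

/-! ### The scalar eigenvalue equation for classical solutions -/

/-- A solution `u` with derivative `u₁`, both square integrable, of the scalar eigenvalue
equation, where `a = √(1-ω²)`. -/
structure IsClassicalEigenfunction (p a l : ℝ) (u u₁ : ℝ → ℝ) : Prop where
  hasDerivAt : ∀ x, HasDerivAt u (u₁ x) x
  hasDerivAt' : ∀ x, HasDerivAt u₁
    ((a ^ 2 - l - (2 * p + 1) * ((p + 1) * a ^ 2 * (1 - Real.tanh (p * a * x) ^ 2))) * u x) x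
  memLp : MemLp u 2 volume
  memLp' : MemLp u₁ 2 volume

theorem eq_zero_of_integral_sq_eq_zero {f : ℝ → ℝ} (hf : Continuous f)
    (h2 : MemLp f 2 volume) (h : ∫ x, f x * f x = 0) (x : ℝ) : f x = 0 := by
  have h' := (integral_eq_zero_iff_of_nonneg (fun x => mul_self_nonneg (f x))
    (integrable_mul_of_memLp_two h2 h2)).1 h
  have h3 := (Continuous.ae_eq_iff_eq volume (hf.mul hf) continuous_zero).1 h'
  exact mul_self_eq_zero.1 (congrFun h3 x)

/-! ### Double factorization of the scalar operator -/

namespace IsClassicalEigenfunction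

variable {p a l : ℝ} {u u₁ : ℝ → ℝ}

/-- The first Darboux transform `(∂ₓ + (p+1) a tanh) u`. -/
noncomputable def darboux (p a : ℝ) (u u₁ : ℝ → ℝ) (x : ℝ) : ℝ :=
  u₁ x + (p + 1) * a * (Real.tanh (p * a * x) * u x)

/-- The second Darboux transform `(∂ₓ + a tanh)(∂ₓ + (p+1) a tanh) u`. -/
noncomputable def darboux₂ (p a l : ℝ) (u u₁ : ℝ → ℝ) (x : ℝ) : ℝ :=
  (p + 2) * a * (Real.tanh (p * a * x) * u₁ x) + ((a ^ 2 - l - (p + 1) ^ 2 * a ^ 2) * u x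
    + (p + 1) * (p + 2) * a ^ 2 * (Real.tanh (p * a * x) * (Real.tanh (p * a * x) * u x)))

/-- In `darboux₂` the second derivative of `u` is already replaced through the equation. Hence its
dependence on `l`, and its square integrability needs nothing beyond `u` and `u₁`. -/
theorem hasDerivAt_darboux (h : IsClassicalEigenfunction p a l u u₁) (x : ℝ) :
    HasDerivAt (darboux p a u u₁)
      (darboux₂ p a l u u₁ x - a * (Real.tanh (p * a * x) * darboux p a u u₁ x)) x := by
  refine ((h.hasDerivAt' x).add ((((hasDerivAt_tanh_mul (p * a) x).mul
    (h.hasDerivAt x)).const_mul ((p + 1) * a)))).congr_deriv ?_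
  simp only [darboux, darboux₂]
  ring

/-- This is `B*B v = l v` for `v = A u`, with `B* = -∂ + a tanh`: the intertwining of the two
factorizations. -/
theorem hasDerivAt_darboux₂ (h : IsClassicalEigenfunction p a l u u₁) (x : ℝ) :
    HasDerivAt (darboux₂ p a l u u₁)
      (a * (Real.tanh (p * a * x) * darboux₂ p a l u u₁ x) - l * darboux p a u u₁ x) x := by
  have hT := hasDerivAt_tanh_mul (p * a) x
  refine (((hT.mul (h.hasDerivAt' x)).const_mul ((p + 2) * a)).add
    (((h.hasDerivAt x).const_mul (a ^ 2 - l - (p + 1) ^ 2 * a ^ 2)).add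
    ((hT.mul (hT.mul (h.hasDerivAt x))).const_mul ((p + 1) * (p + 2) * a ^ 2)))).congr_deriv ?_
  simp only [darboux, darboux₂, Pi.mul_apply]
  ring

theorem memLp_darboux (h : IsClassicalEigenfunction p a l u u₁) :
    MemLp (darboux p a u u₁) 2 volume :=
  h.memLp'.add ((h.memLp.tanh_mul _).const_mul _)

theorem memLp_darboux₂ (h : IsClassicalEigenfunction p a l u u₁) :
    MemLp (darboux₂ p a l u u₁) 2 volume :=
  ((h.memLp'.tanh_mul _).const_mul _).add ((h.memLp.const_mul _).add
    (((h.memLp.tanh_mul _).tanh_mul _).const_mul _))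

/-- `‖B v‖² = l ‖v‖²` for the two Darboux transforms `v` and `B v` of an eigenfunction. -/
theorem integral_darboux₂_sq (h : IsClassicalEigenfunction p a l u u₁) :
    ∫ x, darboux₂ p a l u u₁ x * darboux₂ p a l u u₁ x
      = l * ∫ x, darboux p a u u₁ x * darboux p a u u₁ x := by
  have hv := h.memLp_darboux
  have hz := h.memLp_darboux₂
  have hzd : MemLp (fun x => a * (Real.tanh (p * a * x) * darboux₂ p a l u u₁ x)
      - l * darboux p a u u₁ x) 2 volume :=
    ((hz.tanh_mul _).const_mul _).sub (hv.const_mul _)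
  have hvd : MemLp (fun x => darboux₂ p a l u u₁ x
      - a * (Real.tanh (p * a * x) * darboux p a u u₁ x)) 2 volume :=
    hz.sub ((hv.tanh_mul _).const_mul _)
  have ibp := integral_mul_deriv_eq_neg_of_memLp h.hasDerivAt_darboux₂ h.hasDerivAt_darboux
    hz hzd hv hvd
  -- With `z = B v`, the cross terms `a tanh z v` of `z v'` and `z' v` cancel, leaving `z² - l v²`.
  rw [← sub_eq_zero, sub_neg_eq_add, ← integral_add (integrable_mul_of_memLp_two hz hvd)
    (integrable_mul_of_memLp_two hzd hv)] at ibp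
  rw [← sub_eq_zero, ← integral_const_mul, ← integral_sub (integrable_mul_of_memLp_two hz hz)
    ((integrable_mul_of_memLp_two hv hv).const_mul l), ← ibp]
  refine integral_congr_ae (Filter.Eventually.of_forall fun x => ?_)
  ring

theorem darboux₂_eq_zero (h : IsClassicalEigenfunction p a l u u₁) (hl : l ≤ 0) (x : ℝ) :
    darboux₂ p a l u u₁ x = 0 := by
  refine eq_zero_of_integral_sq_eq_zero
    (continuous_iff_continuousAt.2 fun x => (h.hasDerivAt_darboux₂ x).continuousAt)
    h.memLp_darboux₂ (le_antisymm ?_ (integral_nonneg fun x => mul_self_nonneg _)) x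
  rw [h.integral_darboux₂_sq]
  exact mul_nonpos_of_nonpos_of_nonneg hl (integral_nonneg fun x => mul_self_nonneg _)

theorem darboux_eq_zero (h : IsClassicalEigenfunction p a l u u₁) (hl : l < 0) (x : ℝ) :
    darboux p a u u₁ x = 0 := by
  have h1 := h.integral_darboux₂_sq
  simp only [h.darboux₂_eq_zero hl.le, mul_zero, integral_zero] at h1
  exact eq_zero_of_integral_sq_eq_zero
    (continuous_iff_continuousAt.2 fun x => (h.hasDerivAt_darboux x).continuousAt)
    h.memLp_darboux ((mul_eq_zero.1 h1.symm).resolve_left hl.ne) x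

/-- Subtracting `(p+2) a tanh` times `A u = 0` from `B A u = 0` removes every `tanh` term and leaves
a constant times `u`. -/
theorem eigenvalue_eq_of_neg (h : IsClassicalEigenfunction p a l u u₁) (hl : l < 0) {x : ℝ}
    (hx : u x ≠ 0) : l = -(p * (p + 2)) * a ^ 2 := by
  have h1 := h.darboux_eq_zero hl x
  have h2 := h.darboux₂_eq_zero hl.le x
  simp only [darboux, darboux₂] at h1 h2
  have h3 : (a ^ 2 - l - (p + 1) ^ 2 * a ^ 2) * u x = 0 := by
    linear_combination h2 - (p + 2) * a * Real.tanh (p * a * x) * h1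
  linarith [(mul_eq_zero.1 h3).resolve_right hx]

theorem exists_eq_of_neg (h : IsClassicalEigenfunction p a l u u₁) (hp : 0 < p) (hl : l < 0) :
    ∃ C : ℝ, ∀ x, u x = C * sechPow (p * a) ((p + 1) / p) x := by
  refine exists_eq_mul_sechPow fun x => (h.hasDerivAt x).congr_deriv ?_
  have h1 := h.darboux_eq_zero hl x
  have h2 : (p + 1) / p * (p * a) = (p + 1) * a := by field_simp
  rw [h2]
  rw [darboux] at h1
  linarith

/-- Here `B v = 0` makes `v = A u` a multiple of `sech^(1/p)`. Since `B v = (p+2) a tanh v - p(p+2)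
a² u` at `l = 0`, `u` is recovered algebraically, without a second differential equation. -/
theorem exists_eq_of_zero (h : IsClassicalEigenfunction p a 0 u u₁) (hp : 0 < p) (ha : 0 < a) :
    ∃ C : ℝ, ∀ x, u x = C * (Real.tanh (p * a * x) * sechPow (p * a) (1 / p) x) := by
  have h2 : 1 / p * (p * a) = a := by field_simp
  obtain ⟨C, hC⟩ := exists_eq_mul_sechPow (b := p * a) (t := 1 / p) (u := darboux p a u u₁)
    fun x => (h.hasDerivAt_darboux x).congr_deriv (by
      rw [h.darboux₂_eq_zero le_rfl, h2]; ring)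
  refine ⟨C / (p * a), fun x => ?_⟩
  have h3 := h.darboux₂_eq_zero le_rfl x
  have h4 := hC x
  simp only [darboux, darboux₂] at h3 h4
  have h5 : p * (p + 2) * a ^ 2 * u x = (p + 2) * a * (Real.tanh (p * a * x)
      * (C * sechPow (p * a) (1 / p) x)) := by
    rw [← h4]
    linear_combination -h3
  have h6 : (p + 2) * a ≠ 0 := by positivity
  have h7 : p * a * u x = Real.tanh (p * a * x) * (C * sechPow (p * a) (1 / p) x) :=
    mul_left_cancel₀ h6 (by linear_combination h5)
  rw [div_mul_eq_mul_div, eq_div_iff (by positivity)]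
  linear_combination h7

theorem sechPow_eigenfunction (hp : 0 < p) (ha : 0 < a) :
    IsClassicalEigenfunction p a (-(p * (p + 2)) * a ^ 2) (sechPow (p * a) ((p + 1) / p))
      fun x => -((p + 1) * a) * (Real.tanh (p * a * x) * sechPow (p * a) ((p + 1) / p) x) := by
  have h2 : (p + 1) / p * (p * a) = (p + 1) * a := by field_simp
  have hd : ∀ x, HasDerivAt (sechPow (p * a) ((p + 1) / p)) (-((p + 1) * a)
      * (Real.tanh (p * a * x) * sechPow (p * a) ((p + 1) / p) x)) x := fun x => by
    rw [← h2]; exact hasDerivAt_sechPow _ _ x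
  have hm := memLp_sechPow (b := p * a) (t := (p + 1) / p) (by positivity) (by positivity)
  refine ⟨hd, fun x => ?_, hm, (hm.tanh_mul _).const_mul _⟩
  refine (((hasDerivAt_tanh_mul (p * a) x).mul (hd x)).const_mul _).congr_deriv ?_
  ring

/-- For `a = √(1-ω²)` this is the translation mode `∂ₓ Φ_ω` up to a constant. -/
theorem tanh_mul_sechPow_eigenfunction (hp : 0 < p) (ha : 0 < a) :
    IsClassicalEigenfunction p a 0
      (fun x => Real.tanh (p * a * x) * sechPow (p * a) (1 / p) x)
      fun x => p * a * sechPow (p * a) (1 / p) x + -((p + 1) * a) *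
        (Real.tanh (p * a * x) * (Real.tanh (p * a * x) * sechPow (p * a) (1 / p) x)) := by
  have h2 : 1 / p * (p * a) = a := by field_simp
  have hs : ∀ x, HasDerivAt (sechPow (p * a) (1 / p)) (-a
      * (Real.tanh (p * a * x) * sechPow (p * a) (1 / p) x)) x := fun x => by
    nth_rw 2 [← h2]; exact hasDerivAt_sechPow _ _ x
  have hm := memLp_sechPow (b := p * a) (t := 1 / p) (by positivity) (by positivity)
  have hT := fun x => hasDerivAt_tanh_mul (p * a) x
  refine ⟨fun x => ?_, fun x => ?_, hm.tanh_mul _,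
    (hm.const_mul _).add (((hm.tanh_mul _).tanh_mul _).const_mul _)⟩
  · refine ((hT x).mul (hs x)).congr_deriv ?_
    ring
  · refine (((hs x).const_mul (p * a)).add
      (((hT x).mul ((hT x).mul (hs x))).const_mul (-((p + 1) * a)))).congr_deriv ?_
    simp only [Pi.mul_apply]
    ring

end IsClassicalEigenfunction

end GoodBoussinesq

namespace GoodBoussinesq

/-! ### The profile and its potential -/

variable {p ω l : ℝ}

theorem one_sub_sq_pos (hω : |ω| < 1) : 0 < 1 - ω ^ 2 :=
  sub_pos.2 ((sq_lt_one_iff_abs_lt_one ω).2 hω)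

theorem one_div_cosh_sq (y : ℝ) : (1 / Real.cosh y) ^ 2 = 1 - Real.tanh y ^ 2 := by
  rw [Real.tanh_eq_sinh_div_cosh]
  have := (Real.cosh_pos y).ne'
  field_simp
  linarith [Real.cosh_sq y]

theorem abs_Phi_rpow (hp : 0 < p) (hω : |ω| < 1) (x : ℝ) :
    |Phi p ω x| ^ (2 * p)
      = (p + 1) * √(1 - ω ^ 2) ^ 2 * (1 - Real.tanh (p * √(1 - ω ^ 2) * x) ^ 2) := by
  have h1 := (one_sub_sq_pos hω).le
  have h2 : 1 / (2 * p) * (2 * p) = 1 := by field_simp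
  have h3 : 0 ≤ (p + 1) * (1 / Real.cosh (p * (√(1 - ω ^ 2) * x))) ^ 2 := by positivity
  rw [Phi, groundState, abs_of_nonneg (mul_nonneg (Real.rpow_nonneg h1 _) (Real.rpow_nonneg h3 _)),
    Real.mul_rpow (Real.rpow_nonneg h1 _) (Real.rpow_nonneg h3 _), ← Real.rpow_mul h1,
    ← Real.rpow_mul h3, h2, Real.rpow_one, Real.rpow_one, one_div_cosh_sq, Real.sq_sqrt h1,
    mul_assoc p]
  ring

theorem Phi_eq_mul_sechPow (hp : 0 < p) (x : ℝ) :
    Phi p ω x = (1 - ω ^ 2) ^ (1 / (2 * p)) * (p + 1) ^ (1 / (2 * p))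
      * sechPow (p * √(1 - ω ^ 2)) (1 / p) x := by
  have hc := Real.cosh_pos (p * √(1 - ω ^ 2) * x)
  have e : (1 / Real.cosh (p * √(1 - ω ^ 2) * x)) ^ 2
      = Real.cosh (p * √(1 - ω ^ 2) * x) ^ (-2 : ℝ) := by
    rw [Real.rpow_neg hc.le, Real.rpow_two, one_div, inv_pow]
  rw [Phi, groundState, Real.mul_rpow (by positivity) (by positivity), sechPow, ← mul_assoc,
    ← mul_assoc p, e, ← Real.rpow_mul hc.le]
  congr 2
  field_simp

theorem deriv_Phi (hp : 0 < p) :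
    deriv (Phi p ω) = fun x => -((1 - ω ^ 2) ^ (1 / (2 * p)) * (p + 1) ^ (1 / (2 * p))
      * √(1 - ω ^ 2)) * (Real.tanh (p * √(1 - ω ^ 2) * x)
        * sechPow (p * √(1 - ω ^ 2)) (1 / p) x) := by
  funext x
  rw [funext (Phi_eq_mul_sechPow (ω := ω) hp),
    ((hasDerivAt_sechPow (p * √(1 - ω ^ 2)) (1 / p) x).const_mul _).deriv]
  field_simp

theorem mulPotential_ae_eq (hp : 0 < p) (hω : |ω| < 1) (f : L2) :
    mulPotential p ω hp f =ᵐ[volume] fun x =>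
      (p + 1) * √(1 - ω ^ 2) ^ 2 * (1 - Real.tanh (p * √(1 - ω ^ 2) * x) ^ 2) * f x := by
  have h1 : mulPotential p ω hp f =ᵐ[volume] ⇑(potential p ω hp) • ⇑f :=
    Lp.coeFn_lpSMul (potential p ω hp) f
  filter_upwards [h1, (memLp_top_potential ω hp).coeFn_toLp] with x hx hx'
  rw [hx, Pi.smul_apply', smul_eq_mul, potential, hx', abs_Phi_rpow hp hω]

theorem scalar_rhs_ae_eq (hp : 0 < p) (hω : |ω| < 1) {f : L2} {u : ℝ → ℝ}
    (hu : f =ᵐ[volume] u) :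
    ((1 - ω ^ 2 - l) • f - (2 * p + 1) • mulPotential p ω hp f : L2) =ᵐ[volume] fun x =>
      (√(1 - ω ^ 2) ^ 2 - l - (2 * p + 1) * ((p + 1) * √(1 - ω ^ 2) ^ 2
        * (1 - Real.tanh (p * √(1 - ω ^ 2) * x) ^ 2))) * u x := by
  filter_upwards [Lp.coeFn_sub ((1 - ω ^ 2 - l) • f) ((2 * p + 1) • mulPotential p ω hp f),
    Lp.coeFn_smul (1 - ω ^ 2 - l) f, Lp.coeFn_smul (2 * p + 1) (mulPotential p ω hp f),
    mulPotential_ae_eq hp hω f, hu] with x h1 h2 h3 h4 h5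
  rw [h1, Pi.sub_apply, h2, h3, Pi.smul_apply, Pi.smul_apply, h4, smul_eq_mul, smul_eq_mul, h5,
    Real.sq_sqrt (one_sub_sq_pos hω).le]
  ring

/-- Elliptic regularity: eigenfunctions of the scalar operator are classical. -/
theorem exists_isClassicalEigenfunction {hp : 0 < p} (hω : |ω| < 1) {f : L2}
    (hf : f ∈ eigenspace (scalarOp p ω hp) l) :
    ∃ u u₁, f =ᵐ[volume] u ∧ IsClassicalEigenfunction p √(1 - ω ^ 2) l u u₁ := by
  obtain ⟨g, h1, h2⟩ := mem_eigenspace_scalarOp_iff.1 hf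
  obtain ⟨c, hc⟩ := h1.exists_ae_eq_primitive
  have hT := continuous_tanh_mul (p * √(1 - ω ^ 2))
  have hG : Continuous fun x => c + ∫ t in (0 : ℝ)..x, g t :=
    continuous_const.add (L2.continuous_primitive g)
  -- Bootstrap: `f` has a continuous representative, so the right-hand side of the equation does
  -- too, making `g` and then `f` of class `C¹`.
  obtain ⟨u₁, hu₁, hd₁⟩ := h2.exists_hasDerivAt (by fun_prop) (scalar_rhs_ae_eq hp hω hc)
  obtain ⟨u, hu, hd⟩ := h1.exists_hasDerivAt
    (continuous_iff_continuousAt.2 fun x => (hd₁ x).continuousAt) hu₁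
  have huc : Continuous u := continuous_iff_continuousAt.2 fun x => (hd x).continuousAt
  -- Both representatives of `f` are continuous, hence equal everywhere, so the equation for `u₁`
  -- involves `u` itself.
  have e : u = fun x => c + ∫ t in (0 : ℝ)..x, g t :=
    (Continuous.ae_eq_iff_eq volume huc hG).1 (hu.symm.trans hc)
  refine ⟨u, u₁, hu, hd, fun x => ?_, (memLp_congr_ae hu).1 (Lp.memLp f),
    (memLp_congr_ae hu₁).1 (Lp.memLp g)⟩
  rw [e]
  exact hd₁ x

theorem IsClassicalEigenfunction.toLp_mem_eigenspace {hp : 0 < p} (hω : |ω| < 1) {u u₁ : ℝ → ℝ}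
    (h : IsClassicalEigenfunction p √(1 - ω ^ 2) l u u₁) :
    h.memLp.toLp u ∈ eigenspace (scalarOp p ω hp) l := by
  have hq := scalar_rhs_ae_eq (l := l) hp hω h.memLp.coeFn_toLp
  have hq2 := (memLp_congr_ae hq).1 (Lp.memLp _)
  refine mem_eigenspace_scalarOp_iff.2 ⟨h.memLp'.toLp u₁,
    hasWeakDeriv_toLp h.hasDerivAt h.memLp h.memLp', ?_⟩
  have := hasWeakDeriv_toLp h.hasDerivAt' h.memLp' hq2
  rwa [Lp.ext (hq.trans hq2.coeFn_toLp.symm)]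

/-! ### Spectral properties of the scalar operator -/

theorem eq_smul_toLp {f : L2} {u v : ℝ → ℝ} (hu : f =ᵐ[volume] u) (hv : MemLp v 2 volume) {C : ℝ}
    (h : ∀ x, u x = C * v x) : f = C • hv.toLp v := by
  refine Lp.ext ?_
  filter_upwards [hu, Lp.coeFn_smul C (hv.toLp v), hv.coeFn_toLp] with x h1 h2 h3
  rw [h1, h2, Pi.smul_apply, h3, h x, smul_eq_mul]

theorem eigenvalue_scalarOp_eq {hp : 0 < p} (hω : |ω| < 1) (hl : l < 0)
    (h : IsEigenvalue (scalarOp p ω hp) l) : l = -(p * (p + 2)) * (1 - ω ^ 2) := by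
  obtain ⟨f, hf, hf0⟩ := h
  obtain ⟨u, u₁, hu, hc⟩ := exists_isClassicalEigenfunction hω hf
  have : ∃ x, u x ≠ 0 := by
    by_contra! h0
    refine hf0 (Lp.ext ?_)
    filter_upwards [hu, Lp.coeFn_zero ℝ 2 (volume : Measure ℝ)] with x h1 h2
    rw [h1, h2, h0 x, Pi.zero_apply]
  obtain ⟨x, hx⟩ := this
  rw [hc.eigenvalue_eq_of_neg hl hx, Real.sq_sqrt (one_sub_sq_pos hω).le]

theorem exists_eigenspace_scalarOp_eq_span (hp : 0 < p) (hω : |ω| < 1) :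
    ∃ ψ₀ : L2, ψ₀ ≠ 0 ∧
      eigenspace (scalarOp p ω hp) (-(p * (p + 2)) * (1 - ω ^ 2)) = Submodule.span ℝ {ψ₀} := by
  have ha : 0 < √(1 - ω ^ 2) := Real.sqrt_pos.2 (one_sub_sq_pos hω)
  have hψ := IsClassicalEigenfunction.sechPow_eigenfunction hp ha
  rw [Real.sq_sqrt (one_sub_sq_pos hω).le] at hψ
  have hmem := hψ.toLp_mem_eigenspace (hp := hp) hω
  refine ⟨hψ.memLp.toLp _, fun h0 => ?_, le_antisymm (fun f hf => ?_) ?_⟩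
  · have h1 : sechPow (p * √(1 - ω ^ 2)) ((p + 1) / p) =ᵐ[volume] fun _ => 0 := by
      filter_upwards [hψ.memLp.coeFn_toLp, Lp.coeFn_zero ℝ 2 (volume : Measure ℝ)] with x h1 h2
      rw [← h1, h0, h2, Pi.zero_apply]
    have h2 := (Continuous.ae_eq_iff_eq volume (continuous_sechPow _ _) continuous_const).1 h1
    exact (sechPow_pos _ _ 0).ne' (congrFun h2 0)
  · obtain ⟨u, u₁, hu, hc⟩ := exists_isClassicalEigenfunction hω hf
    have hneg : -(p * (p + 2)) * (1 - ω ^ 2) < 0 :=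
      mul_neg_of_neg_of_pos (neg_lt_zero.2 (by positivity)) (one_sub_sq_pos hω)
    obtain ⟨C, hC⟩ := hc.exists_eq_of_neg hp hneg
    exact Submodule.mem_span_singleton.2 ⟨C, (eq_smul_toLp hu hψ.memLp hC).symm⟩
  · rwa [Submodule.span_singleton_le_iff_mem]

theorem memLp_deriv_Phi (hp : 0 < p) (hω : |ω| < 1) : MemLp (deriv (Phi p ω)) 2 volume := by
  rw [deriv_Phi hp]
  exact (IsClassicalEigenfunction.tanh_mul_sechPow_eigenfunction hp
    (Real.sqrt_pos.2 (one_sub_sq_pos hω))).memLp.const_mul _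

theorem eigenspace_scalarOp_zero (hp : 0 < p) (hω : |ω| < 1) :
    eigenspace (scalarOp p ω hp) 0
      = Submodule.span ℝ {(memLp_deriv_Phi hp hω).toLp (deriv (Phi p ω))} := by
  have ha0 := one_sub_sq_pos hω
  have ha : 0 < √(1 - ω ^ 2) := Real.sqrt_pos.2 ha0
  have hχ := IsClassicalEigenfunction.tanh_mul_sechPow_eigenfunction hp ha
  set A := -((1 - ω ^ 2) ^ (1 / (2 * p)) * (p + 1) ^ (1 / (2 * p)) * √(1 - ω ^ 2)) with hA
  have hA0 : A ≠ 0 := neg_ne_zero.2 (by positivity)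
  have hd : ∀ x, deriv (Phi p ω) x = A * (Real.tanh (p * √(1 - ω ^ 2) * x)
      * sechPow (p * √(1 - ω ^ 2)) (1 / p) x) := congrFun (deriv_Phi hp)
  refine le_antisymm (fun f hf => ?_) ?_
  · obtain ⟨u, u₁, hu, hc⟩ := exists_isClassicalEigenfunction hω hf
    obtain ⟨C, hC⟩ := hc.exists_eq_of_zero hp ha
    refine Submodule.mem_span_singleton.2 ⟨C / A, (eq_smul_toLp hu _ fun x => ?_).symm⟩
    rw [hC x, hd x, ← mul_assoc (C / A), div_mul_cancel₀ _ hA0]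
  · rw [Submodule.span_singleton_le_iff_mem,
      eq_smul_toLp (memLp_deriv_Phi hp hω).coeFn_toLp hχ.memLp hd]
    exact Submodule.smul_mem _ _ (hχ.toLp_mem_eigenspace hω)

/-! ### The eigenvalues of the matrix operator -/

theorem sub_div_neg (ω : ℝ) (hl : l < 0) : l - ω ^ 2 * l / (l - 1) < 0 := by
  have h1 : l - 1 < 0 := by linarith
  have e : l - ω ^ 2 * l / (l - 1) = l * (l - 1 - ω ^ 2) / (l - 1) := by
    have := h1.ne
    field_simp
  rw [e]
  exact div_neg_of_pos_of_neg (mul_pos_of_neg_of_neg hl (by nlinarith [sq_nonneg ω])) h1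

/-- The negative solution of the quadratic equation linking the eigenvalues of the two
operators. -/
theorem sub_div_eq_iff {m : ℝ} (hm : m < 0) (hl : l < 0) :
    l - ω ^ 2 * l / (l - 1) = m ↔ l = 1 / 2 * (m + ω ^ 2 + 1
      - √(m ^ 2 + 2 * (ω ^ 2 - 1) * m + (ω ^ 2 + 1) ^ 2)) := by
  have h1 : l - 1 ≠ 0 := by linarith
  have hD : m ^ 2 + 2 * (ω ^ 2 - 1) * m + (ω ^ 2 + 1) ^ 2 = (m + ω ^ 2 + 1) ^ 2 - 4 * m := by ring
  have hD0 : 0 ≤ (m + ω ^ 2 + 1) ^ 2 - 4 * m := by nlinarith [sq_nonneg (m + ω ^ 2 + 1)]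
  have hq : l - ω ^ 2 * l / (l - 1) = m ↔ l ^ 2 - (m + ω ^ 2 + 1) * l + m = 0 := by
    rw [sub_eq_iff_eq_add, ← sub_eq_iff_eq_add', eq_div_iff h1]
    constructor <;> intro h <;> linarith
  rw [hq, hD]
  constructor
  · intro h
    -- Dividing the quadratic by `l` turns this quantity into `m/l - l`, positive since `l, m < 0`:
    -- `l` is the smaller root.
    have h2 : 0 ≤ m + ω ^ 2 + 1 - 2 * l := by nlinarith
    have h3 : √((m + ω ^ 2 + 1) ^ 2 - 4 * m) = m + ω ^ 2 + 1 - 2 * l := by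
      rw [← Real.sqrt_sq h2]
      congr 1
      linear_combination -4 * h
    rw [h3]
    ring
  · intro h
    have h2 := Real.sq_sqrt hD0
    have h3 : √((m + ω ^ 2 + 1) ^ 2 - 4 * m) = m + ω ^ 2 + 1 - 2 * l := by linarith
    rw [h3] at h2
    linarith

/-- The radicand is `(m + ω² + 1)² - 4m`, which exceeds the square because `m < 0`. -/
theorem half_sub_sqrt_neg {m : ℝ} (hm : m < 0) :
    1 / 2 * (m + ω ^ 2 + 1 - √(m ^ 2 + 2 * (ω ^ 2 - 1) * m + (ω ^ 2 + 1) ^ 2)) < 0 := by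
  have : m + ω ^ 2 + 1 < √(m ^ 2 + 2 * (ω ^ 2 - 1) * m + (ω ^ 2 + 1) ^ 2) :=
    Real.lt_sqrt_of_sq_lt (by linarith)
  linarith

theorem isEigenvalue_matrixOp_iff {hp : 0 < p} (hl : l ≠ 1) :
    IsEigenvalue (matrixOp p ω hp) l
      ↔ IsEigenvalue (scalarOp p ω hp) (l - ω ^ 2 * l / (l - 1)) := by
  constructor
  · rintro ⟨w, hw, hw0⟩
    obtain ⟨h1, h2⟩ := (mem_eigenspace_matrixOp_iff hl).1 hw
    refine ⟨w.1, h1, fun h => hw0 (Prod.ext h ?_)⟩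
    rw [h2, h, smul_zero]
    rfl
  · rintro ⟨f, hf, hf0⟩
    exact ⟨(f, (ω / (l - 1)) • f), (mem_eigenspace_matrixOp_iff hl).2 ⟨hf, rfl⟩,
      fun h => hf0 (congrArg Prod.fst h)⟩

/-- Simplicity transfers because the first component determines the second linearly. -/
theorem eigenspace_matrixOp_eq_span {hp : 0 < p} (hl : l ≠ 1) {ψ : L2}
    (h : eigenspace (scalarOp p ω hp) (l - ω ^ 2 * l / (l - 1)) = Submodule.span ℝ {ψ}) :
    eigenspace (matrixOp p ω hp) l = Submodule.span ℝ {(ψ, (ω / (l - 1)) • ψ)} := by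
  ext w
  rw [mem_eigenspace_matrixOp_iff hl, h, Submodule.mem_span_singleton,
    Submodule.mem_span_singleton]
  constructor
  · rintro ⟨⟨C, hC⟩, h2⟩
    refine ⟨C, Prod.ext hC ?_⟩
    rw [h2, ← hC, smul_comm (ω / (l - 1)) C ψ]
    rfl
  · rintro ⟨C, rfl⟩
    exact ⟨⟨C, rfl⟩, smul_comm C (ω / (l - 1)) ψ⟩

end GoodBoussinesq

/-! ### Kernel and negative spectrum of the two operators -/

theorem mainTheorem8 (p ω : ℝ) (hp : 0 < p) (hω : |ω| < 1) :
    -- the kernel of the matrix operator is the line spanned by `∂ₓ(Φ_ω, -ω Φ_ω)`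
    (∃ dΦ : GoodBoussinesq.L2 × GoodBoussinesq.L2,
      dΦ.1 =ᵐ[volume] deriv (GoodBoussinesq.Phi p ω) ∧
      dΦ.2 =ᵐ[volume] deriv (fun x => -ω * GoodBoussinesq.Phi p ω x) ∧
      ∀ w : GoodBoussinesq.L2 × GoodBoussinesq.L2,
        w ∈ GoodBoussinesq.kernel (GoodBoussinesq.matrixOp p ω hp) ↔ ∃ C : ℝ, w = C • dΦ) ∧
    -- the scalar operator has exactly one negative eigenvalue `lm`
    (∃! lm : ℝ, lm < 0 ∧ GoodBoussinesq.IsEigenvalue (GoodBoussinesq.scalarOp p ω hp) lm) ∧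
    -- the matrix operator has exactly one negative eigenvalue
    (∃! l : ℝ, l < 0 ∧ GoodBoussinesq.IsEigenvalue (GoodBoussinesq.matrixOp p ω hp) l) ∧
    -- both are simple, and those of the matrix operator are given by those of the scalar one
    (∀ lm l0 : ℝ, lm < 0 → GoodBoussinesq.IsEigenvalue (GoodBoussinesq.scalarOp p ω hp) lm →
      l0 < 0 → GoodBoussinesq.IsEigenvalue (GoodBoussinesq.matrixOp p ω hp) l0 →
      l0 = 1 / 2 * (lm + ω ^ 2 + 1
        - √(lm ^ 2 + 2 * (ω ^ 2 - 1) * lm + (ω ^ 2 + 1) ^ 2)) ∧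
      ∃ ψ₀ : GoodBoussinesq.L2, ψ₀ ≠ 0 ∧
        GoodBoussinesq.eigenspace (GoodBoussinesq.scalarOp p ω hp) lm
          = Submodule.span ℝ {ψ₀} ∧
        GoodBoussinesq.eigenspace (GoodBoussinesq.matrixOp p ω hp) l0
          = Submodule.span ℝ {(ψ₀, (ω / (l0 - 1)) • ψ₀)}) := by
  have ha := GoodBoussinesq.one_sub_sq_pos hω
  obtain ⟨ψ₀, hψ0, hψ⟩ := GoodBoussinesq.exists_eigenspace_scalarOp_eq_span hp hω
  set m := -(p * (p + 2)) * (1 - ω ^ 2) with hm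
  have hm0 : m < 0 := mul_neg_of_neg_of_pos (neg_lt_zero.2 (by positivity)) ha
  have hme : GoodBoussinesq.IsEigenvalue (GoodBoussinesq.scalarOp p ω hp) m :=
    ⟨ψ₀, hψ ▸ Submodule.mem_span_singleton_self ψ₀, hψ0⟩
  have hmu : ∀ l, l < 0 → GoodBoussinesq.IsEigenvalue (GoodBoussinesq.scalarOp p ω hp) l →
      l = m := fun l hl h => GoodBoussinesq.eigenvalue_scalarOp_eq hω hl h
  have hmat : ∀ l, l < 0 → GoodBoussinesq.IsEigenvalue (GoodBoussinesq.matrixOp p ω hp) l →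
      l - ω ^ 2 * l / (l - 1) = m := fun l hl h =>
    hmu _ (GoodBoussinesq.sub_div_neg ω hl)
      ((GoodBoussinesq.isEigenvalue_matrixOp_iff (by linarith)).1 h)
  refine ⟨?_, ⟨m, ⟨hm0, hme⟩, fun l h => hmu l h.1 h.2⟩, ?_, ?_⟩
  · have hd := GoodBoussinesq.memLp_deriv_Phi hp hω
    refine ⟨(hd.toLp _, (-ω) • hd.toLp _), hd.coeFn_toLp, ?_, fun w => ?_⟩
    · have e : deriv (fun x => -ω * GoodBoussinesq.Phi p ω x)
          = fun x => -ω * deriv (GoodBoussinesq.Phi p ω) x :=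
        funext fun x => deriv_const_mul_field (-ω)
      rw [e]
      filter_upwards [Lp.coeFn_smul (-ω) (hd.toLp _), hd.coeFn_toLp] with x h1 h2
      rw [h1, Pi.smul_apply, h2, smul_eq_mul]
    · have h0 := GoodBoussinesq.eigenspace_scalarOp_zero hp hω
      -- At `l = 0` the scalar parameter is again `0` and the factor `ω/(l-1)` is `-ω`, matching the
      -- second component of the profile.
      have h1 : (0 : ℝ) - ω ^ 2 * 0 / (0 - 1) = 0 := by ring
      have h2 : ω / (0 - 1) = -ω := by ring
      rw [← h1] at h0
      rw [GoodBoussinesq.kernel_eq_eigenspace_zero,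
        GoodBoussinesq.eigenspace_matrixOp_eq_span zero_ne_one h0, h2,
        Submodule.mem_span_singleton]
      exact exists_congr fun C => eq_comm
  · have hl := GoodBoussinesq.half_sub_sqrt_neg (ω := ω) hm0
    refine ⟨_, ⟨hl, (GoodBoussinesq.isEigenvalue_matrixOp_iff (by linarith)).2 ?_⟩,
      fun l h => (GoodBoussinesq.sub_div_eq_iff hm0 h.1).1 (hmat l h.1 h.2)⟩
    rwa [(GoodBoussinesq.sub_div_eq_iff hm0 hl).2 rfl]
  · intro lm l0 hlm hlme hl0 hl0e
    obtain rfl := hmu lm hlm hlme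
    have h := hmat l0 hl0 hl0e
    refine ⟨(GoodBoussinesq.sub_div_eq_iff hm0 hl0).1 h, ψ₀, hψ0, hψ, ?_⟩
    exact GoodBoussinesq.eigenspace_matrixOp_eq_span (by linarith) (h.symm ▸ hψ)
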